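/- **Setting.** Let $n\ge 1$. Jobs arrive at rate $\lambda>0$ to a system of $n$ parallel clusters; cluster $k$ has $m_k\ge 1$ exponential servers of rate $\mu_k>0$, serves in first-come first-served order and has unlimited buffer space; $\lambda<\sum_k m_k\mu_k$. An arriving job is rejected, at cost $R>0$, or routed to one cluster. The action is $\mathbf a=(a_k)\in\{0,1\}^n$ with $\sum_k(1-a_k)\le 1$, where $a_k=0$ means that an arriving job would be routed to cluster $k$. Job deadlines are independent with law $F$ on $[0,\infty)$ of finite mean, and a missed deadline costs $1$. Let $T_k(x)$ be the response time of a job that finds $x$ jobs at cluster $k$, and put $$P_k^{\rm miss}(x)=\int_0^\infty \mathsf P\{T_k(x)>t\}\,dF(t),\qquad \bar\mu_k(x)=\min(x,m_k)\mu_k,\qquad h_k(0)=0,\quad h_k(x)=\bar\mu_k(x)\,P_k^{\rm miss}(x-1)\ (x\ge1).$$ Let $\boldsymbol\Pi$ be the class of admissible policies: at each time the action may depend on the history of states and actions and on additional randomization, but not on the future. The queue lengths $X_k(t)$ then go up by one at rate $\lambda(1-a_k(t))$ and down by one at rate $\bar\mu_k(X_k(t))$. For an initial state $\mathbf x^0$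 and $\pi\in\boldsymbol\Pi$ put $$J(\pi)=\limsup_{T\to\infty}\frac1T\mathsf E^\pi_{\mathbf x^0}\!\int_0^T\sum_k\{\lambda Ra_k(t)+\lambda P_k^{\rm miss}(X_k(t))(1-a_k(t))\}\,dt,$$ $$\widetilde J(\pi)=\limsup_{T\to\infty}\frac1T\mathsf E^\pi_{\mathbf x^0}\!\int_0^T\sum_k\{R\lambda a_k(t)+h_k(X_k(t))\}\,dt.$$ Call $\pi$ *rate-stable* (from $\mathbf x^0$) if $\mathsf E^\pi_{\mathbf x^0}[X_k(T)]/T\to0$ as $T\to\infty$ for every $k$. **Proposition.** The problem of minimizing $J$ and the problem of minimizing $\widetilde J$ are equivalent, in the following sense. (a) For every initial state, $J(\pi)=\widetilde J(\pi)$ for every rate-stable $\pi\in\boldsymbol\Pi$. Over the class of rate-stable policies the two problems have the same optimal average cost per unit time and the same optimal policies. (b) If, for a given initial state, some rate-stable policy minimizes $\widetilde J$ over all of $\boldsymbol\Pi$, then $\inf_{\boldsymbol\Pi}J=\inf_{\boldsymbol\Pi}\widetilde J$, and a rate-stable policy minimizes $J$ over $\boldsymbol\Pi$ if and only if it minimizes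 $\widetilde J$ over $\boldsymbol\Pi$. (c) The dynamic programming equations of the two problems have the same optimal values and prescribe the same optimal actions. Precisely, for a cost rate $c(\mathbf x,\mathbf a)$ consider the equations, in the unknowns $v\in\mathbb R$ and $b:\mathbb Z_{\ge0}^n\to\mathbb R$, $$v=\min_{\mathbf a}\Big\{c(\mathbf x,\mathbf a)+\sum_k\lambda(1-a_k)\big(b(\mathbf x+\mathbf e_k)-b(\mathbf x)\big)+\sum_{k:\,x_k\ge1}\bar\mu_k(x_k)\big(b(\mathbf x-\mathbf e_k)-b(\mathbf x)\big)\Big\}\quad\text{for all }\mathbf x\in\mathbb Z_{\ge0}^n.$$ For every $v\in\mathbb R$ and every assignment of a set $D(\mathbf x)$ of actions to each state $\mathbf x$: the equations with $c=\sum_k\{\lambda Ra_k+\lambda P_k^{\rm miss}(x_k)(1-a_k)\}$ have a solution $(v,b)$ whose set of minimizing actions in each state $\mathbf x$ is $D(\mathbf x)$ if and only if the equations with $c=\sum_k\{R\lambda a_k+h_k(x_k)\}$ have a solution $(v,\widetilde b)$ with this property. -/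

import Mathlib

open MeasureTheory ProbabilityTheory Filter Topology
open scoped NNReal

noncomputable section

namespace SoftRT

/-- Parameters of the system: `n` parallel clusters, Poisson arrivals of rate `lam`, rejection cost
`R`, cluster `k` with `m k` exponential servers of rate `mu k`, and the law `F` of the (relative)
deadline of a job, which is nonnegative with finite mean. The load is less than one. -/
structure Model (n : ℕ) where
  lam : ℝ
  R : ℝ
  m : Fin n → ℕ
  mu : Fin n → ℝ
  F : Measure ℝ
  lam_pos : 0 < lam
  R_pos : 0 < R
  m_pos : ∀ k, 1 ≤ m k
  mu_pos : ∀ k, 0 < mu k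
  load_lt_one : lam / (∑ k, (m k : ℝ) * mu k) < 1
  F_prob : IsProbabilityMeasure F
  F_nonneg : F (Set.Iio 0) = 0
  F_mean : Integrable (fun t : ℝ => t) F
  n_pos : 0 < n

/-- A joint state: the number of jobs (waiting or in service) at every cluster. -/
abbrev State (n : ℕ) : Type := Fin n → ℕ

/-- A joint action: `none` rejects an arriving job (all entry gates are shut), `some k` routes it to
cluster `k` (only gate `k` is open). These are the vectors `(a_k) ∈ {0,1}ⁿ` with
`∑ k, (1 - a_k) ≤ 1`. -/
def Action (n : ℕ) : Type := Option (Fin n)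

instance (n : ℕ) : MeasurableSpace (Action n) := ⊤

/-- The coordinate `a_k` of an action: `0` if gate `k` is open, `1` if it is shut. -/
def gate {n : ℕ} (a : Action n) (k : Fin n) : ℝ :=
  open Classical in if a = some k then 0 else 1

/-- Law of the response time, under FCFS, of a job that finds `x` jobs at a cluster with `m` servers
of rate `mu`. If a server is free the job is served at once. Otherwise all `m` servers are busy, the
next departure takes an exponential time of rate `m * mu`, and from then on the job is in the
position of one that has found one job less. -/
def responseLaw (m : ℕ) (mu : ℝ) : ℕ → Measure ℝ
  | 0 => expMeasure mu
  | x + 1 =>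
      if x + 1 < m then expMeasure mu
      else (expMeasure ((m : ℝ) * mu)).conv (responseLaw m mu x)

namespace Model

variable {n : ℕ} (S : Model n)

/-- `P_k^miss(x)`: the probability that a job routed to cluster `k` when `x` jobs are there misses
its deadline, `∫ P{T_k(x) > t} dF(t)`. -/
def missProb (k : Fin n) (x : ℕ) : ℝ :=
  ∫ t, (responseLaw (S.m k) (S.mu k) x).real (Set.Ioi t) ∂S.F

/-- Total service rate `min(x, m_k) μ_k` at cluster `k` when it holds `x` jobs. -/
def serviceRate (k : Fin n) (x : ℕ) : ℝ := (min x (S.m k) : ℕ) * S.mu k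

/-- Holding cost rate `h_k`. -/
def holdingCost (k : Fin n) : ℕ → ℝ
  | 0 => 0
  | x + 1 => S.serviceRate k (x + 1) * S.missProb k x

/-- Cost rate of the original problem: `∑ k, {λ R a_k + λ P_k^miss(x_k) (1 - a_k)}`. -/
def missCostRate (x : State n) (a : Action n) : ℝ :=
  ∑ k, (S.lam * S.R * gate a k + S.lam * S.missProb k (x k) * (1 - gate a k))

/-- Cost rate of the modified problem: `∑ k, {R λ a_k + h_k(x_k)}`. -/
def holdCostRate (x : State n) (a : Action n) : ℝ :=
  ∑ k, (S.R * S.lam * gate a k + S.holdingCost k (x k))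

/-- Generator of the joint queue length process under action `a`: arrivals join cluster `k` at rate
`λ (1 - a_k)`, departures from cluster `k` occur at rate `min(x_k, m_k) μ_k`. (At `x_k = 0` the
departure rate vanishes.) -/
def gen (f : State n → ℝ) (a : Action n) (x : State n) : ℝ :=
  ∑ k, (S.lam * (1 - gate a k) * (f (x + Pi.single k 1) - f x)
    + S.serviceRate k (x k) * (f (x - Pi.single k 1) - f x))

end Model

/-- The history of states and actions: `σ(X_s, A_s : s ≤ t)`. -/
def history {n : ℕ} {Ω : Type} [mΩ : MeasurableSpace Ω] (X : ℝ≥0 → Ω → State n)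
    (A : ℝ≥0 → Ω → Action n) (hX : Measurable (Function.uncurry X))
    (hA : Measurable (Function.uncurry A)) : Filtration ℝ≥0 mΩ where
  seq t := ⨆ s : Set.Iic t,
    (MeasurableSpace.comap (X s) inferInstance ⊔ MeasurableSpace.comap (A s) inferInstance)
  mono' := by
    intro t t' h
    exact iSup_le fun s => le_iSup (fun s : Set.Iic t' =>
      MeasurableSpace.comap (X s) inferInstance ⊔ MeasurableSpace.comap (A s) inferInstance)
      ⟨s.1, le_trans s.2 h⟩
  le' := by
    intro t
    refine iSup_le fun s => sup_le ?_ ?_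
    · exact (hX.comp measurable_prodMk_left).comap_le
    · exact (hA.comp measurable_prodMk_left).comap_le

/-- An admissible policy for the initial state `x0`, together with the process it controls: a
queue length process `X` and an action process `A` on some probability space, such that, given the
history of states and actions, `X` is a jump process that at time `t` moves according to the
generator for the action `A t` (controlled martingale problem). The action may depend in any
measurable way on the history of states and actions, and on additional randomization, but not on the
future; no stationarity or Markov property is asked for. -/
structure Policy {n : ℕ} (S : Model n) (x0 : State n) where
  Ω : Type
  mΩ : MeasurableSpace Ω
  P : Measure Ω
  prob : IsProbabilityMeasure P
  X : ℝ≥0 → Ω → State n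
  A : ℝ≥0 → Ω → Action n
  measurable_X : Measurable (Function.uncurry X)
  measurable_A : Measurable (Function.uncurry A)
  init : ∀ᵐ ω ∂P, X 0 ω = x0
  right_cont : ∀ ω t, ContinuousWithinAt (fun s => X s ω) (Set.Ici t) t
  left_lim : ∀ ω t, ∃ l, Tendsto (fun s => X s ω) (𝓝[<] t) (𝓝 l)
  martingale : ∀ f : State n → ℝ, (∃ C, ∀ x, |f x| ≤ C) →
    Martingale (fun t ω => f (X t ω) -
        ∫ s in (0 : ℝ)..t, S.gen f (A s.toNNReal ω) (X s.toNNReal ω))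
      (history X A measurable_X measurable_A) P

namespace Policy

variable {n : ℕ} {S : Model n} {x0 : State n}

/-- Long-run expected average cost per unit time under `π` for the cost rate `c`. -/
def avgCost (π : Policy S x0) (c : State n → Action n → ℝ) : EReal :=
  letI := π.mΩ
  limsup (fun T : ℝ≥0 =>
    (((1 / (T : ℝ)) *
      ∫ ω, (∫ s in (0 : ℝ)..T, c (π.X s.toNNReal ω) (π.A s.toNNReal ω)) ∂π.P : ℝ) : EReal)) atTop

/-- Rate stability: no queue builds up at a positive rate, `E[X_k(T)] / T → 0`. -/
def RateStable (π : Policy S x0) : Prop :=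
  letI := π.mΩ
  ∀ k, Tendsto (fun T : ℝ≥0 => (∫ ω, (π.X T ω k : ℝ) ∂π.P) / (T : ℝ)) atTop (𝓝 0)

end Policy

/-- The optimal average cost over a class `Adm` of policies. -/
def optCost {n : ℕ} {S : Model n} {x0 : State n} (Adm : Set (Policy S x0))
    (c : State n → Action n → ℝ) : EReal :=
  ⨅ π ∈ Adm, π.avgCost c

/-- The average-cost optimal policies in a class `Adm` of policies. -/
def optPolicies {n : ℕ} {S : Model n} {x0 : State n} (Adm : Set (Policy S x0))
    (c : State n → Action n → ℝ) : Set (Policy S x0) :=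
  {π | π ∈ Adm ∧ ∀ π' ∈ Adm, π.avgCost c ≤ π'.avgCost c}

/-- The average-cost optimality (DP) equations for the cost rate `c`, in the unknowns `v` and `b`:
for every state, `v` is the minimum over the actions of the cost rate plus the expected drift
of `b`. -/
def SolvesDP {n : ℕ} (S : Model n) (c : State n → Action n → ℝ) (v : ℝ) (b : State n → ℝ) : Prop :=
  ∀ x, IsLeast (Set.range fun a : Action n => c x a + S.gen b a x) v

/-- The actions attaining the minimum in the DP equation for state `x`. -/
def dpActions {n : ℕ} (S : Model n) (c : State n → Action n → ℝ) (b : State n → ℝ) (x : State n) :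
    Set (Action n) :=
  {a | ∀ a' : Action n, c x a + S.gen b a x ≤ c x a' + S.gen b a' x}

end SoftRT

end

open MeasureTheory ProbabilityTheory Filter Topology
open scoped NNReal

noncomputable section

namespace SoftRT

/-! Let Φ(x) = ∑ₖ ∑_{j < xₖ} Pₖ^miss(j) (`missPotential`). An arrival at cluster k raises Φ by
Pₖ^miss(xₖ) and a departure lowers it by Pₖ^miss(xₖ - 1), so the drift of Φ is exactly the original
cost rate minus the modified one (`missCostRate_eq`).

By Dynkin's formula the expected costs up to T differ by E Φ(X_T) - Φ(x⁰) (`expCost_missCostRate`).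
Since Φ ≥ 0, the modified average cost never exceeds the original one, under any policy; since Φ ≤
∑ₖ xₖ, rate stability makes the difference o(T) and the two averages agree. This gives (a), and (b)
by squeezing the infima. For (c), replacing b by b + Φ or b - Φ carries one DP equation into the
other, action by action.

The martingale property is given for bounded functions only, while Φ is in general unbounded. It is
reached through the truncations min(Φ, N): jumps of size at most one and bounded rates bound their
drifts uniformly in N. -/

instance (n : ℕ) : Finite (Action n) := inferInstanceAs (Finite (Option (Fin n)))

instance (n : ℕ) : DiscreteMeasurableSpace (Action n) := ⟨fun _ => trivial⟩

lemma gate_mem_Icc {n : ℕ} (a : Action n) (k : Fin n) : 0 ≤ gate a k ∧ gate a k ≤ 1 := by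
  unfold gate
  split_ifs <;> norm_num

lemma isProbabilityMeasure_responseLaw {m : ℕ} {mu : ℝ} (hm : 1 ≤ m) (hmu : 0 < mu) (x : ℕ) :
    IsProbabilityMeasure (responseLaw m mu x) := by
  have h1 : IsProbabilityMeasure (expMeasure mu) := isProbabilityMeasure_expMeasure hmu
  have h2 : IsProbabilityMeasure (expMeasure ((m : ℝ) * mu)) :=
    isProbabilityMeasure_expMeasure (mul_pos (by exact_mod_cast hm) hmu)
  induction x with
  | zero => exact h1
  | succ x ih =>
    unfold responseLaw
    split_ifs
    · exact h1
    · infer_instance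

namespace Model

variable {n : ℕ} (S : Model n)

lemma missProb_nonneg (k : Fin n) (x : ℕ) : 0 ≤ S.missProb k x :=
  integral_nonneg fun _ => measureReal_nonneg

lemma missProb_le_one (k : Fin n) (x : ℕ) : S.missProb k x ≤ 1 := by
  have := S.F_prob
  have := isProbabilityMeasure_responseLaw (S.m_pos k) (S.mu_pos k) x
  have h : ‖S.missProb k x‖ ≤ 1 * S.F.real Set.univ := by
    refine norm_integral_le_of_norm_le_const (Eventually.of_forall fun t => ?_)
    rw [Real.norm_of_nonneg measureReal_nonneg]
    exact measureReal_le_one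
  simp only [probReal_univ, mul_one] at h
  exact (le_abs_self _).trans h

lemma serviceRate_zero (k : Fin n) : S.serviceRate k 0 = 0 := by
  simp [serviceRate]

lemma serviceRate_nonneg (k : Fin n) (x : ℕ) : 0 ≤ S.serviceRate k x :=
  mul_nonneg (Nat.cast_nonneg _) (S.mu_pos k).le

lemma serviceRate_le (k : Fin n) (x : ℕ) : S.serviceRate k x ≤ S.m k * S.mu k :=
  mul_le_mul_of_nonneg_right (by exact_mod_cast min_le_right _ _) (S.mu_pos k).le

/-! ### Generator: linearity, bounds, truncation -/

lemma gen_add (f g : State n → ℝ) (a : Action n) (x : State n) :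
    S.gen (fun y => f y + g y) a x = S.gen f a x + S.gen g a x := by
  unfold gen
  rw [← Finset.sum_add_distrib]
  exact Finset.sum_congr rfl fun k _ => by ring

lemma gen_sub (f g : State n → ℝ) (a : Action n) (x : State n) :
    S.gen (fun y => f y - g y) a x = S.gen f a x - S.gen g a x := by
  unfold gen
  rw [← Finset.sum_sub_distrib]
  exact Finset.sum_congr rfl fun k _ => by ring

/-- An upper bound on the total rate of jumps. -/
def jumpRate : ℝ := ∑ k, (S.lam + S.m k * S.mu k)

/-- A function on states that changes by at most one when a job arrives or departs. -/
def UnitIncrements (f : State n → ℝ) : Prop :=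
  ∀ x k, |f (x + Pi.single k 1) - f x| ≤ 1 ∧ |f (x - Pi.single k 1) - f x| ≤ 1

lemma UnitIncrements.min_const {f : State n → ℝ} (hf : UnitIncrements f) (c : ℝ) :
    UnitIncrements fun x => min (f x) c := fun x k =>
  ⟨(abs_min_sub_min_le_max _ _ _ _).trans (by simpa using (hf x k).1),
    (abs_min_sub_min_le_max _ _ _ _).trans (by simpa using (hf x k).2)⟩

lemma abs_gen_le {f : State n → ℝ} (hf : UnitIncrements f) (a : Action n) (x : State n) :
    |S.gen f a x| ≤ S.jumpRate := by
  refine (Finset.abs_sum_le_sum_abs _ _).trans (Finset.sum_le_sum fun k _ => ?_)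
  obtain ⟨h1, h2⟩ := hf x k
  obtain ⟨h3, h4⟩ := gate_mem_Icc a k
  have h5 := S.lam_pos
  refine (abs_add_le _ _).trans (add_le_add ?_ ?_)
  · rw [abs_mul, abs_of_nonneg (mul_nonneg h5.le (by linarith))]
    calc S.lam * (1 - gate a k) * _ ≤ S.lam * 1 * 1 := by gcongr; linarith
      _ = S.lam := by ring
  · rw [abs_mul, abs_of_nonneg (S.serviceRate_nonneg _ _)]
    calc S.serviceRate k (x k) * _ ≤ (S.m k * S.mu k) * 1 :=
          mul_le_mul (S.serviceRate_le _ _) h2 (abs_nonneg _)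
            ((S.serviceRate_nonneg k (x k)).trans (S.serviceRate_le _ _))
      _ = _ := mul_one _

/-- One jump raises `f` by at most one, so with a margin of one the truncation is invisible to the
generator. -/
lemma gen_min_eq {f : State n → ℝ} (hf : UnitIncrements f) {c : ℝ} {x : State n}
    (hc : f x + 1 ≤ c) (a : Action n) : S.gen (fun y => min (f y) c) a x = S.gen f a x := by
  unfold gen
  refine Finset.sum_congr rfl fun k _ => ?_
  obtain ⟨h1, h2⟩ := hf x k
  rw [abs_le] at h1 h2
  simp only [min_eq_left (show f x ≤ c by linarith),
    min_eq_left (show f (x + Pi.single k 1) ≤ c by linarith),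
    min_eq_left (show f (x - Pi.single k 1) ≤ c by linarith)]

/-! ### The potential and its drift -/

/-- The expected number of deadlines missed by the arrivals that built up the present queues; its
drift is the difference of the two cost rates. -/
def missPotential (x : State n) : ℝ := ∑ k, ∑ j ∈ Finset.range (x k), S.missProb k j

lemma missPotential_nonneg (x : State n) : 0 ≤ S.missPotential x :=
  Finset.sum_nonneg fun k _ => Finset.sum_nonneg fun _ _ => S.missProb_nonneg k _

lemma missPotential_le (x : State n) : S.missPotential x ≤ ∑ k, (x k : ℝ) := by
  refine Finset.sum_le_sum fun k _ => ?_
  simpa using Finset.sum_le_sum (s := Finset.range (x k)) fun j _ => S.missProb_le_one k j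

lemma missPotential_add_single (x : State n) (k : Fin n) :
    S.missPotential (x + Pi.single k 1) - S.missPotential x = S.missProb k (x k) := by
  unfold missPotential
  rw [← Finset.sum_sub_distrib, Finset.sum_eq_single k]
  · simp [Finset.sum_range_succ]
  · intro j _ hj
    simp [hj]
  · simp

lemma sub_single_add_single {x : State n} {k : Fin n} (h : x k ≠ 0) :
    x - Pi.single k 1 + Pi.single k 1 = x := by
  ext j
  by_cases hj : j = k
  · subst hj
    simp
    omega
  · simp [hj]

/-- Subtraction of naturals truncates at zero, so a departure from an empty cluster is a null move.
-/
lemma sub_single_eq_self {x : State n} {k : Fin n} (h : x k = 0) : x - Pi.single k 1 = x := by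
  ext j
  by_cases hj : j = k
  · subst hj
    simp [h]
  · simp [hj]

lemma missPotential_sub_single {x : State n} {k : Fin n} (h : x k ≠ 0) :
    S.missPotential (x - Pi.single k 1) - S.missPotential x = -S.missProb k (x k - 1) := by
  have := S.missPotential_add_single (x - Pi.single k 1) k
  rw [sub_single_add_single h] at this
  simp at this
  linarith

lemma unitIncrements_missPotential : UnitIncrements S.missPotential := by
  intro x k
  constructor
  · rw [missPotential_add_single, abs_of_nonneg (S.missProb_nonneg _ _)]
    exact S.missProb_le_one _ _
  · by_cases h : x k = 0
    · simp [sub_single_eq_self h]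
    · rw [S.missPotential_sub_single h, abs_neg, abs_of_nonneg (S.missProb_nonneg _ _)]
      exact S.missProb_le_one _ _

lemma unitIncrements_coord (i : Fin n) : UnitIncrements fun x : State n => (x i : ℝ) := by
  intro x k
  by_cases hj : i = k
  · subst hj
    constructor
    · simp
    · rcases Nat.eq_zero_or_pos (x i) with h | h
      · simp [h]
      · simp [Nat.cast_sub h]
  · simp [hj]

/-- Cluster by cluster, the arrival part of the drift is the expected miss cost and the departure
part is minus the holding cost. In an empty cluster the departure part and the holding cost both
vanish. -/
lemma missCostRate_eq (x : State n) (a : Action n) :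
    S.missCostRate x a = S.holdCostRate x a + S.gen S.missPotential a x := by
  unfold missCostRate holdCostRate gen
  rw [← Finset.sum_add_distrib]
  refine Finset.sum_congr rfl fun k _ => ?_
  rw [missPotential_add_single]
  rcases h : x k with _ | j
  · simp only [serviceRate_zero, holdingCost]
    ring
  · rw [S.missPotential_sub_single (by omega), h]
    simp only [holdingCost, Nat.add_sub_cancel]
    ring

lemma exists_abs_missCostRate_le : ∃ C, ∀ x a, |S.missCostRate x a| ≤ C := by
  refine ⟨∑ _k : Fin n, (S.lam * S.R + S.lam), fun x a =>
    (Finset.abs_sum_le_sum_abs _ _).trans (Finset.sum_le_sum fun k _ => ?_)⟩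
  obtain ⟨h3, h4⟩ := gate_mem_Icc a k
  have h5 := S.lam_pos
  have h6 := S.R_pos
  have h7 := S.missProb_nonneg k (x k)
  have h8 : 0 ≤ 1 - gate a k := by linarith
  rw [abs_of_nonneg (by positivity)]
  refine add_le_add (mul_le_of_le_one_right (by positivity) h4) ?_
  rw [mul_assoc]
  exact mul_le_of_le_one_right h5.le (mul_le_one₀ (S.missProb_le_one _ _) h8 (by linarith))

lemma exists_abs_holdCostRate_le : ∃ C, ∀ x a, |S.holdCostRate x a| ≤ C := by
  obtain ⟨C, hC⟩ := S.exists_abs_missCostRate_le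
  refine ⟨C + S.jumpRate, fun x a => ?_⟩
  have h := S.missCostRate_eq x a
  have : S.holdCostRate x a = S.missCostRate x a - S.gen S.missPotential a x := by linarith
  rw [this]
  exact (abs_sub _ _).trans
    (add_le_add (hC x a) (S.abs_gen_le S.unitIncrements_missPotential a x))

end Model

namespace Policy

variable {n : ℕ} {S : Model n} {x0 : State n} (π : Policy S x0)

/-! ### Accumulated costs: measurability and integrability -/

/-- The cost accumulated on a path up to time `T` at the cost rate `c`. -/
def cumCost (c : State n → Action n → ℝ) (T : ℝ≥0) (ω : π.Ω) : ℝ :=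
  ∫ s in (0 : ℝ)..T, c (π.X s.toNNReal ω) (π.A s.toNNReal ω)

/-- The expected cost accumulated up to time `T` at the cost rate `c`. -/
def expCost (c : State n → Action n → ℝ) (T : ℝ≥0) : ℝ :=
  letI := π.mΩ
  ∫ ω, π.cumCost c T ω ∂π.P

/-- The expected value of a function of the queue lengths at time `T`. -/
def expVal (f : State n → ℝ) (T : ℝ≥0) : ℝ :=
  letI := π.mΩ
  ∫ ω, f (π.X T ω) ∂π.P

lemma measurable_cost (c : State n → Action n → ℝ) :
    letI := π.mΩ
    Measurable fun p : ℝ × π.Ω => c (π.X p.1.toNNReal p.2) (π.A p.1.toNNReal p.2) := by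
  let := π.mΩ
  have h : Measurable fun p : ℝ × π.Ω => (p.1.toNNReal, p.2) :=
    (measurable_real_toNNReal.comp measurable_fst).prodMk measurable_snd
  exact (Measurable.of_discrete (f := fun q : State n × Action n => c q.1 q.2)).comp
    ((π.measurable_X.comp h).prodMk (π.measurable_A.comp h))

lemma measurable_state (f : State n → ℝ) (T : ℝ≥0) :
    letI := π.mΩ
    Measurable fun ω => f (π.X T ω) := by
  let := π.mΩ
  exact (Measurable.of_discrete (f := f)).comp (π.measurable_X.comp measurable_prodMk_left)

lemma measurable_cumCost (c : State n → Action n → ℝ) (T : ℝ≥0) :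
    letI := π.mΩ
    Measurable (π.cumCost c T) := by
  let := π.mΩ
  have h : π.cumCost c T = fun ω =>
      ∫ s in Set.Ioc 0 (T : ℝ), c (π.X s.toNNReal ω) (π.A s.toNNReal ω) :=
    funext fun ω => intervalIntegral.integral_of_le T.2
  rw [h]
  exact (StronglyMeasurable.integral_prod_right (ν := volume.restrict (Set.Ioc 0 (T : ℝ)))
    (f := fun (ω : π.Ω) (s : ℝ) => c (π.X s.toNNReal ω) (π.A s.toNNReal ω))
    ((π.measurable_cost c).comp measurable_swap).stronglyMeasurable).measurable

lemma intervalIntegrable_cost {c : State n → Action n → ℝ} {C : ℝ} (hC : ∀ x a, |c x a| ≤ C)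
    (T : ℝ≥0) (ω : π.Ω) :
    IntervalIntegrable (fun s : ℝ => c (π.X s.toNNReal ω) (π.A s.toNNReal ω)) volume 0 T := by
  let := π.mΩ
  refine (intervalIntegrable_const (c := C)).mono_fun
    ((π.measurable_cost c).comp measurable_prodMk_right).aestronglyMeasurable
    (Eventually.of_forall fun s => ?_)
  exact (hC _ _).trans (le_abs_self _)

lemma abs_cumCost_le {c : State n → Action n → ℝ} {C : ℝ} (hC : ∀ x a, |c x a| ≤ C)
    (T : ℝ≥0) (ω : π.Ω) : |π.cumCost c T ω| ≤ C * T := by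
  have := intervalIntegral.norm_integral_le_of_norm_le_const (a := (0 : ℝ)) (b := T)
    (f := fun s : ℝ => c (π.X s.toNNReal ω) (π.A s.toNNReal ω)) (C := C) fun s _ => hC _ _
  simpa [cumCost] using this

lemma integrable_cumCost {c : State n → Action n → ℝ} {C : ℝ} (hC : ∀ x a, |c x a| ≤ C)
    (T : ℝ≥0) :
    letI := π.mΩ
    Integrable (π.cumCost c T) π.P := by
  let := π.mΩ
  have := π.prob
  exact Integrable.of_bound (π.measurable_cumCost c T).aestronglyMeasurable (C * T)
    (Eventually.of_forall (π.abs_cumCost_le hC T))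

lemma expCost_add {c d : State n → Action n → ℝ} {C D : ℝ} (hC : ∀ x a, |c x a| ≤ C)
    (hD : ∀ x a, |d x a| ≤ D) (T : ℝ≥0) :
    π.expCost (fun x a => c x a + d x a) T = π.expCost c T + π.expCost d T := by
  let := π.mΩ
  unfold expCost
  rw [← integral_add (π.integrable_cumCost hC T) (π.integrable_cumCost hD T)]
  congr 1
  ext ω
  exact intervalIntegral.integral_add (π.intervalIntegrable_cost hC T ω)
    (π.intervalIntegrable_cost hD T ω)

lemma abs_expCost_le {c : State n → Action n → ℝ} {C : ℝ} (hC : ∀ x a, |c x a| ≤ C) (T : ℝ≥0) :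
    |π.expCost c T| ≤ C * T := by
  let := π.mΩ
  have := π.prob
  have := norm_integral_le_of_norm_le_const (μ := π.P) (f := π.cumCost c T)
    (Eventually.of_forall (π.abs_cumCost_le hC T))
  simpa [expCost] using this

/-! ### Dynkin's formula, bounded and then truncated -/

/-- Dynkin's formula for bounded functions. -/
lemma expVal_eq_of_bounded {f : State n → ℝ} (hf : ∃ C, ∀ x, |f x| ≤ C) {C : ℝ}
    (hC : ∀ x a, |S.gen f a x| ≤ C) (T : ℝ≥0) :
    π.expVal f T = f x0 + π.expCost (fun x a => S.gen f a x) T := by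
  let := π.mΩ
  have := π.prob
  -- Integrated over the whole space, the martingale property says that the means at times 0 and `T`
  -- agree.
  have hM := (π.martingale f hf).setIntegral_eq (zero_le : 0 ≤ T) MeasurableSet.univ
  simp only [setIntegral_univ, NNReal.coe_zero, intervalIntegral.integral_same, sub_zero] at hM
  have h0 : ∫ ω, f (π.X 0 ω) ∂π.P = f x0 := by
    rw [integral_congr_ae (g := fun _ => f x0) (π.init.mono fun ω h => by simp only [h])]
    simp
  obtain ⟨B, hB⟩ := hf
  have hi : Integrable (fun ω => f (π.X T ω)) π.P :=
    Integrable.of_bound (π.measurable_state f T).aestronglyMeasurable B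
      (Eventually.of_forall fun ω => hB _)
  have h1 := integral_sub hi (π.integrable_cumCost hC T)
  simp only [cumCost] at h1
  rw [h1, h0] at hM
  simp only [expVal, expCost, cumCost]
  linarith

lemma tendsto_min_natCast (y : ℝ) : Tendsto (fun N : ℕ => min y (N : ℝ)) atTop (𝓝 y) := by
  obtain ⟨N0, hN0⟩ := exists_nat_ge y
  refine tendsto_const_nhds.congr' ?_
  filter_upwards [eventually_ge_atTop N0] with N hN
  exact (min_eq_left (hN0.trans (by exact_mod_cast hN))).symm

lemma expVal_min {f : State n → ℝ} (hf : Model.UnitIncrements f) (h0 : ∀ x, 0 ≤ f x) (N : ℕ)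
    (T : ℝ≥0) : π.expVal (fun x => min (f x) N) T
      = min (f x0) N + π.expCost (fun x a => S.gen (fun y => min (f y) N) a x) T :=
  π.expVal_eq_of_bounded ⟨N, fun x => by
    rw [abs_of_nonneg (le_min (h0 x) N.cast_nonneg)]
    exact min_le_right _ _⟩ (fun x a => S.abs_gen_le (hf.min_const N) a x) T

/-- Fatou's lemma along the truncations, whose means are at most f(x⁰) + `jumpRate` · T whatever the
level N. -/
lemma integrable_state {f : State n → ℝ} (hf : Model.UnitIncrements f) (h0 : ∀ x, 0 ≤ f x)
    (T : ℝ≥0) :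
    letI := π.mΩ
    Integrable (fun ω => f (π.X T ω)) π.P := by
  let := π.mΩ
  have := π.prob
  have hmin : ∀ (N : ℕ) x, 0 ≤ min (f x) (N : ℝ) := fun N x => le_min (h0 x) N.cast_nonneg
  have hmeas : ∀ N : ℕ, Measurable fun ω => min (f (π.X T ω)) (N : ℝ) := fun N =>
    π.measurable_state (fun x => min (f x) (N : ℝ)) T
  refine ⟨(π.measurable_state f T).aestronglyMeasurable, ?_⟩
  have hlim : ∀ ω, ‖f (π.X T ω)‖ₑ
      = liminf (fun N : ℕ => ‖min (f (π.X T ω)) (N : ℝ)‖ₑ) atTop := fun ω =>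
    (tendsto_min_natCast (f (π.X T ω))).enorm.liminf_eq.symm
  rw [hasFiniteIntegral_iff_enorm, lintegral_congr hlim]
  refine (lintegral_liminf_le fun N => (hmeas N).enorm).trans_lt
    (lt_of_le_of_lt ?_ (ENNReal.ofReal_lt_top (r := f x0 + S.jumpRate * T)))
  refine (liminf_le_liminf (v := fun _ => ENNReal.ofReal (f x0 + S.jumpRate * T))
    (Eventually.of_forall fun N => ?_)).trans_eq (liminf_const _)
  have hi : Integrable (fun ω => min (f (π.X T ω)) (N : ℝ)) π.P :=
    Integrable.of_bound
      (π.measurable_state (fun x => min (f x) (N : ℝ)) T).aestronglyMeasurable N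
      (Eventually.of_forall fun ω => by
        rw [Real.norm_of_nonneg (hmin N _)]
        exact min_le_right _ _)
  have h1 : ∫⁻ ω, ‖min (f (π.X T ω)) (N : ℝ)‖ₑ ∂π.P
      = ENNReal.ofReal (π.expVal (fun x => min (f x) N) T) := by
    rw [expVal, ofReal_integral_eq_lintegral_ofReal hi (Eventually.of_forall fun ω => hmin N _)]
    exact lintegral_congr fun ω => Real.enorm_of_nonneg (hmin N _)
  rw [h1, π.expVal_min hf h0]
  exact ENNReal.ofReal_le_ofReal (add_le_add (min_le_left _ _)
    ((le_abs_self _).trans (π.abs_expCost_le (fun x a => S.abs_gen_le (hf.min_const N) a x) T)))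

/-- Dynkin's formula for nonnegative functions that change by at most one at each jump. -/
lemma expVal_eq {f : State n → ℝ} (hf : Model.UnitIncrements f) (h0 : ∀ x, 0 ≤ f x) (T : ℝ≥0) :
    π.expVal f T = f x0 + π.expCost (fun x a => S.gen f a x) T := by
  let := π.mΩ
  have := π.prob
  have hgen : ∀ (N : ℕ) x a, |S.gen (fun y => min (f y) (N : ℝ)) a x| ≤ S.jumpRate :=
    fun N x a => S.abs_gen_le (hf.min_const N) a x
  have hl : Tendsto (fun N : ℕ => π.expVal (fun x => min (f x) N) T) atTop (𝓝 (π.expVal f T)) := by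
    refine tendsto_integral_of_dominated_convergence (fun ω => f (π.X T ω))
      (fun N => (π.measurable_state (fun x => min (f x) (N : ℝ)) T).aestronglyMeasurable)
      (π.integrable_state hf h0 T) (fun N => Eventually.of_forall fun ω => ?_)
      (Eventually.of_forall fun ω => tendsto_min_natCast _)
    rw [Real.norm_of_nonneg (le_min (h0 _) N.cast_nonneg)]
    exact min_le_left _ _
  have hr : Tendsto (fun N : ℕ => π.expCost (fun x a => S.gen (fun y => min (f y) N) a x) T) atTop
      (𝓝 (π.expCost (fun x a => S.gen f a x) T)) := by
    refine tendsto_integral_of_dominated_convergence (fun _ => S.jumpRate * T)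
      (fun N => (π.measurable_cumCost _ T).aestronglyMeasurable) (integrable_const _)
      (fun N => Eventually.of_forall (π.abs_cumCost_le (hgen N) T))
      (Eventually.of_forall fun ω => ?_)
    refine intervalIntegral.tendsto_integral_filter_of_dominated_convergence
      (fun _ => S.jumpRate)
      (Eventually.of_forall fun N => ((π.measurable_cost fun x a =>
        S.gen (fun y => min (f y) (N : ℝ)) a x).comp measurable_prodMk_right).aestronglyMeasurable)
      (Eventually.of_forall fun N => Eventually.of_forall fun s _ => hgen N _ _)
      intervalIntegrable_const (Eventually.of_forall fun s _ => ?_)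
    -- At a fixed path and time, the truncated drift equals the true one as soon as N is at least f
    -- + 1.
    obtain ⟨N0, hN0⟩ := exists_nat_ge (f (π.X s.toNNReal ω) + 1)
    refine tendsto_const_nhds.congr' ?_
    filter_upwards [eventually_ge_atTop N0] with N hN
    exact (S.gen_min_eq hf (hN0.trans (by exact_mod_cast hN)) _).symm
  refine tendsto_nhds_unique hl ?_
  simp only [π.expVal_min hf h0]
  exact (tendsto_min_natCast _).add hr

/-! ### Comparison of the average costs -/

lemma expCost_missCostRate (T : ℝ≥0) : π.expCost S.missCostRate T
    = π.expCost S.holdCostRate T + (π.expVal S.missPotential T - S.missPotential x0) := by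
  obtain ⟨C, hC⟩ := S.exists_abs_holdCostRate_le
  have h1 : S.missCostRate = fun x a => S.holdCostRate x a + S.gen S.missPotential a x := by
    ext x a
    exact S.missCostRate_eq x a
  rw [h1, π.expCost_add hC fun x a => S.abs_gen_le S.unitIncrements_missPotential a x,
    π.expVal_eq S.unitIncrements_missPotential S.missPotential_nonneg]
  ring

lemma expVal_missPotential_nonneg (T : ℝ≥0) : 0 ≤ π.expVal S.missPotential T :=
  integral_nonneg fun _ => S.missPotential_nonneg _

lemma expVal_missPotential_le (T : ℝ≥0) :
    π.expVal S.missPotential T ≤ ∑ k, π.expVal (fun x => (x k : ℝ)) T := by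
  let := π.mΩ
  have hi : ∀ k, Integrable (fun ω => (π.X T ω k : ℝ)) π.P := fun k =>
    π.integrable_state (Model.unitIncrements_coord k) (fun _ => Nat.cast_nonneg _) T
  unfold expVal
  rw [← integral_finsetSum _ fun k _ => hi k]
  exact integral_mono (π.integrable_state S.unitIncrements_missPotential S.missPotential_nonneg T)
    (integrable_finsetSum _ fun k _ => hi k) fun ω => S.missPotential_le _

lemma avgCost_eq (c : State n → Action n → ℝ) :
    π.avgCost c = limsup (fun T : ℝ≥0 => ((1 / (T : ℝ) * π.expCost c T : ℝ) : EReal)) atTop := rfl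

lemma tendsto_const_div_coe (c : ℝ) : Tendsto (fun T : ℝ≥0 => c / (T : ℝ)) atTop (𝓝 0) :=
  tendsto_const_nhds.div_atTop (NNReal.tendsto_coe_atTop.2 tendsto_id)

/-- Subadditivity of the limsup in `EReal`; the excluded sums of opposite infinities cannot occur
because the second limsup is 0. -/
lemma limsup_coe_le {ι : Type*} {l : Filter ι} [l.NeBot] {u v w : ι → ℝ}
    (h : ∀ i, u i ≤ v i + w i) (hw : Tendsto w l (𝓝 0)) :
    limsup (fun i => (u i : EReal)) l ≤ limsup (fun i => (v i : EReal)) l := by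
  have hw' : limsup (fun i => (w i : EReal)) l = 0 :=
    (EReal.tendsto_coe.2 hw).limsup_eq
  calc limsup (fun i => (u i : EReal)) l
      ≤ limsup ((fun i => (v i : EReal)) + fun i => (w i : EReal)) l :=
        limsup_le_limsup (Eventually.of_forall fun i => by
          simpa [← EReal.coe_add] using h i)
    _ ≤ limsup (fun i => (v i : EReal)) l + limsup (fun i => (w i : EReal)) l :=
        EReal.limsup_add_le (.inr (by simp [hw'])) (.inr (by simp [hw']))
    _ = _ := by rw [hw', add_zero]

lemma avgCost_holdCostRate_le : π.avgCost S.holdCostRate ≤ π.avgCost S.missCostRate := by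
  simp only [avgCost_eq]
  refine limsup_coe_le (w := fun T => S.missPotential x0 / (T : ℝ)) (fun T => ?_)
    (tendsto_const_div_coe _)
  have h1 := π.expCost_missCostRate T
  have h2 := π.expVal_missPotential_nonneg T
  rw [one_div_mul_eq_div, one_div_mul_eq_div, ← add_div]
  -- Nonnegativity of `T` suffices: at `T = 0` all quotients are 0 by convention.
  exact div_le_div_of_nonneg_right (by linarith) T.2

lemma RateStable.avgCost_eq {π : Policy S x0} (h : π.RateStable) :
    π.avgCost S.missCostRate = π.avgCost S.holdCostRate := by
  refine le_antisymm ?_ π.avgCost_holdCostRate_le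
  simp only [Policy.avgCost_eq]
  refine limsup_coe_le (w := fun T => ∑ k, π.expVal (fun x => (x k : ℝ)) T / (T : ℝ))
    (fun T => ?_) ?_
  · have h1 := π.expCost_missCostRate T
    have h2 := π.expVal_missPotential_le T
    have h3 := S.missPotential_nonneg x0
    rw [one_div_mul_eq_div, one_div_mul_eq_div, ← Finset.sum_div, ← add_div]
    exact div_le_div_of_nonneg_right (by linarith) T.2
  · rw [← Finset.sum_const_zero (ι := Fin n) (s := Finset.univ)]
    exact tendsto_finsetSum Finset.univ fun k _ => h k

end Policy

/-! ### Optimal costs and optimal policies -/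

section Optimality

variable {n : ℕ} {S : Model n} {x0 : State n} {Adm : Set (Policy S x0)}
  {c d : State n → Action n → ℝ}

lemma optCost_congr (h : ∀ π ∈ Adm, π.avgCost c = π.avgCost d) : optCost Adm c = optCost Adm d :=
  iInf_congr fun π => iInf_congr (h π)

lemma optPolicies_congr (h : ∀ π ∈ Adm, π.avgCost c = π.avgCost d) :
    optPolicies Adm c = optPolicies Adm d := by
  ext π
  refine and_congr_right fun hπ => forall₂_congr fun π' hπ' => ?_
  rw [h π hπ, h π' hπ']

lemma optCost_eq_of_mem_optPolicies {π : Policy S x0} (h : π ∈ optPolicies Adm c) :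
    optCost Adm c = π.avgCost c :=
  le_antisymm (iInf₂_le π h.1) (le_iInf₂ h.2)

lemma mem_optPolicies_iff {π : Policy S x0} :
    π ∈ optPolicies Adm c ↔ π ∈ Adm ∧ π.avgCost c ≤ optCost Adm c := by
  simp only [optPolicies, optCost, le_iInf_iff, Set.mem_ofPred_eq]

/-- The modified cost is the smaller one for every policy, and the rate-stable minimizer attains the
modified infimum with its original cost. -/
lemma optCost_eq_of_rateStable_mem {π : Policy S x0} (h : π ∈ optPolicies Adm S.holdCostRate)
    (hs : π.RateStable) : optCost Adm S.missCostRate = optCost Adm S.holdCostRate := by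
  refine le_antisymm ?_ (iInf₂_mono fun π' _ => π'.avgCost_holdCostRate_le)
  rw [optCost_eq_of_mem_optPolicies h, ← hs.avgCost_eq]
  exact iInf₂_le π h.1

end Optimality

/-! ### Dynamic programming equations -/

section DynamicProgramming

variable {n : ℕ} {S : Model n} {c d : State n → Action n → ℝ} {b b' : State n → ℝ}

lemma solvesDP_congr (h : ∀ x a, c x a + S.gen b a x = d x a + S.gen b' a x) (v : ℝ) :
    SolvesDP S c v b ↔ SolvesDP S d v b' := by
  simp only [SolvesDP, h]

lemma dpActions_congr (h : ∀ x a, c x a + S.gen b a x = d x a + S.gen b' a x) :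
    dpActions S c b = dpActions S d b' := by
  ext x a
  simp only [dpActions, h]

end DynamicProgramming

end SoftRT

end

theorem proposition2p1 {n : ℕ} (S : SoftRT.Model n) :
    (∀ x0 : SoftRT.State n,
      -- a rate-stable policy has the same average cost in both problems
      (∀ π : SoftRT.Policy S x0, π.RateStable →
        π.avgCost S.missCostRate = π.avgCost S.holdCostRate) ∧
      -- same optimal average cost and same optimal policies
      SoftRT.optCost {π : SoftRT.Policy S x0 | π.RateStable} S.missCostRate
        = SoftRT.optCost {π : SoftRT.Policy S x0 | π.RateStable} S.holdCostRate ∧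
      SoftRT.optPolicies {π : SoftRT.Policy S x0 | π.RateStable} S.missCostRate
        = SoftRT.optPolicies {π : SoftRT.Policy S x0 | π.RateStable} S.holdCostRate ∧
      -- the same without restricting the class of policies, once the modified problem has a
      -- rate-stable optimal policy
      ((∃ π ∈ SoftRT.optPolicies (Set.univ : Set (SoftRT.Policy S x0)) S.holdCostRate,
          π.RateStable) →
        SoftRT.optCost (Set.univ : Set (SoftRT.Policy S x0)) S.missCostRate
          = SoftRT.optCost (Set.univ : Set (SoftRT.Policy S x0)) S.holdCostRate ∧
        ∀ π : SoftRT.Policy S x0, π.RateStable →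
          (π ∈ SoftRT.optPolicies Set.univ S.missCostRate ↔
            π ∈ SoftRT.optPolicies Set.univ S.holdCostRate))) ∧
    -- the DP equations have the same optimal values and prescribe the same optimal actions
    (∀ (v : ℝ) (D : SoftRT.State n → Set (SoftRT.Action n)),
      (∃ b, SoftRT.SolvesDP S S.missCostRate v b ∧
          ∀ x, D x = SoftRT.dpActions S S.missCostRate b x) ↔
        (∃ b, SoftRT.SolvesDP S S.holdCostRate v b ∧
          ∀ x, D x = SoftRT.dpActions S S.holdCostRate b x)) := by
  refine ⟨fun x0 => ⟨fun π h => h.avgCost_eq, SoftRT.optCost_congr fun π h => h.avgCost_eq,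
    SoftRT.optPolicies_congr fun π h => h.avgCost_eq, ?_⟩, fun v D => ⟨?_, ?_⟩⟩
  · rintro ⟨π₀, h₀, hs₀⟩
    have heq := SoftRT.optCost_eq_of_rateStable_mem h₀ hs₀
    refine ⟨heq, fun π hs => ?_⟩
    -- Optimality compares a policy's own cost with the infimum, so rate stability of competing
    -- policies is not needed.
    rw [SoftRT.mem_optPolicies_iff, SoftRT.mem_optPolicies_iff, heq, hs.avgCost_eq]
  · rintro ⟨b, hb, hD⟩
    -- The drift of the potential moves from the cost rate into the relative value function.
    have h : ∀ x a, S.missCostRate x a + S.gen b a x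
        = S.holdCostRate x a + S.gen (fun y => b y + S.missPotential y) a x := fun x a => by
      rw [S.missCostRate_eq, S.gen_add]
      ring
    exact ⟨_, (SoftRT.solvesDP_congr h v).1 hb, fun x => by rw [hD, SoftRT.dpActions_congr h]⟩
  · rintro ⟨b, hb, hD⟩
    have h : ∀ x a, S.holdCostRate x a + S.gen b a x
        = S.missCostRate x a + S.gen (fun y => b y - S.missPotential y) a x := fun x a => by
      rw [S.missCostRate_eq, S.gen_sub]
      ring
    exact ⟨_, (SoftRT.solvesDP_congr h v).1 hb, fun x => by rw [hD, SoftRT.dpActions_congr h]⟩
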